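/- Let $n\ge 1$. Let $\mathbb U(n)$ be the space of real upper triangular $n\times n$ matrices $m=(m_{i,j})_{1\le i\le j\le n}$, let $\widetilde{\mathbb U}(n)$ be the space of such matrices with the $(n,n)$ entry deleted, and let $\psi:\mathbb U(n)\to\widetilde{\mathbb U}(n)$ be the projection that deletes this entry. For $1\le i\le n$ the $i$-th hook sum is $$\eta_i(m)=m_{i,i}+\sum_{j>i}m_{i,j}-\sum_{j<i}m_{j,i};$$ for $i\le n-1$ it does not involve $m_{n,n}$, so $\eta_i(\tilde b)$ also makes sense for $\tilde b\in\widetilde{\mathbb U}(n)$. Let $L_n$ be the matrix of the linear map $m\mapsto(\eta_1(m),\dots,\eta_n(m))$ and $P_n$ the matrix of $\psi$. For $a\in\mathbb R_{\ge0}^n$ the Tesler polytope is $$\operatorname{Tes}_n(a)=\{m\in\mathbb U(n) : L_nm=a,\ m_{i,j}\ge 0\text{ for all } i\le j\}.$$ A system $Ex=\alpha_0$, $Gx\le\beta_0$ with solution set the polytope $P_0$ is a minimal description of $P_0$ if $Ex=\alpha_0$ defines the affine span of $P_0$, each inequality defines a facet of $P_0$, and none of the equalities and inequalities is redundant. Let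 $g_i$ be the rows of $G$ and $F_i$ the facet of $P_0$ on which $\langle g_i,x\rangle=\beta_{0,i}$. A polytope $Q$ is a deformation of $P_0$ with deforming vector $(a,b)$ with respect to $(E,G)$ if 1. $Q=\{x : Ex=a,\ Gx\le b\}$, and this description is tight (each constraint holds with equality at some point of $Q$); 2. for every vertex $v$ of $P_0$, the intersection of $Q$ with the hyperplanes $\langle g_i,x\rangle=b_i$, taken over all $i$ with $v\in F_i$, is a single point, which is a vertex of $Q$. The deformation cone of $P_0$ with respect to $(E,G)$ is the set of all deforming vectors $(a,b)$ of deformations of $P_0$. **Theorem.** Let $a_0\in\mathbb R_{>0}^n$. Then $L_nm=a_0$, $-P_nm\le 0$ is a minimal description of $\operatorname{Tes}_n(a_0)$, and the deformation cone of $\operatorname{Tes}_n(a_0)$ with respect to $(L_n,-P_n)$ is $$\{(a,\tilde b)\in\mathbb R^n\times\widetilde{\mathbb U}(n) : \eta_i(\tilde b)\ge -a_i\text{ for all }1\le i\le n-1\}.$$ Moreover, every deformation of $\operatorname{Tes}_n(a_0)$ (with respect to $(L_n,-P_n)$) is a translation of a Tesler polytope, i.e. equals $t+\operatorname{Tes}_n(a)$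 for some $t\in\mathbb U(n)$ and $a\in\mathbb R_{\ge0}^n$. -/

import Mathlib

open scoped Pointwise Matrix

noncomputable section

/-! ### Polytopes, minimal descriptions, deformations -/

namespace Deform

variable {ι κ μ : Type*} [Fintype ι]

/-- A polyhedron: the solution set of finitely many linear inequalities `⟨c, x⟩ ≤ d`. -/
def IsPolyhedron (P : Set (ι → ℝ)) : Prop :=
  ∃ s : Finset ((ι → ℝ) × ℝ), P = {x | ∀ c ∈ s, c.1 ⬝ᵥ x ≤ c.2}

/-- A polytope: a bounded polyhedron. -/
def IsPolytope (P : Set (ι → ℝ)) : Prop :=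
  IsPolyhedron P ∧ Bornology.IsBounded P

/-- The vertices of a polytope. -/
def Vert (P : Set (ι → ℝ)) : Set (ι → ℝ) := P.extremePoints ℝ

/-- The solution set of the linear system `E x = a`, `G x ≤ b`. -/
def solutionSet (E : Matrix κ ι ℝ) (a : κ → ℝ) (G : Matrix μ ι ℝ) (b : μ → ℝ) : Set (ι → ℝ) :=
  {x | E *ᵥ x = a ∧ G *ᵥ x ≤ b}

/-- `F_i`: the part of `P` lying on the hyperplane `⟨g_i, x⟩ = β_i`, with `g_i` the `i`-th row
of `G`. -/
def boundaryFace (P : Set (ι → ℝ)) (G : Matrix μ ι ℝ) (β : μ → ℝ) (i : μ) : Set (ι → ℝ) :=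
  {x ∈ P | (G *ᵥ x) i = β i}

/-- The inequality `⟨g, x⟩ ≤ c` defines a facet of `P`: it is valid on `P`, and the face of `P`
where equality holds is non-empty, of dimension `dim P - 1`. -/
def DefinesFacet (P : Set (ι → ℝ)) (g : ι → ℝ) (c : ℝ) : Prop :=
  (∀ x ∈ P, g ⬝ᵥ x ≤ c) ∧ {x ∈ P | g ⬝ᵥ x = c}.Nonempty ∧
    Module.finrank ℝ (vectorSpan ℝ {x ∈ P | g ⬝ᵥ x = c}) + 1 =
      Module.finrank ℝ (vectorSpan ℝ P)

/-- `E x = α`, `G x ≤ β` is a minimal linear inequality description of the polytope `P`: the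
equalities define the affine span of `P`, each inequality defines a facet of `P`, and none of the
equalities and inequalities is redundant. -/
structure IsMinimalDescription (E : Matrix κ ι ℝ) (α : κ → ℝ) (G : Matrix μ ι ℝ) (β : μ → ℝ)
    (P : Set (ι → ℝ)) : Prop where
  isPolytope : IsPolytope P
  eq_solutionSet : P = solutionSet E α G β
  affineSpan_eq : (affineSpan ℝ P : Set (ι → ℝ)) = {x | E *ᵥ x = α}
  definesFacet : ∀ i, DefinesFacet P (G i) (β i)
  eq_irredundant : ∀ i, {x | (∀ k, k ≠ i → (E *ᵥ x) k = α k) ∧ G *ᵥ x ≤ β} ≠ P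
  le_irredundant : ∀ i, {x | E *ᵥ x = α ∧ ∀ k, k ≠ i → (G *ᵥ x) k ≤ β k} ≠ P

/-- `Q` is defined by the system `E x = a`, `G x ≤ b`, and this description is tight: every
constraint is attained with equality at some point of `Q`. -/
def IsTightDescription (E : Matrix κ ι ℝ) (a : κ → ℝ) (G : Matrix μ ι ℝ) (b : μ → ℝ)
    (Q : Set (ι → ℝ)) : Prop :=
  Q = solutionSet E a G b ∧ (∀ i, ∃ x ∈ Q, (E *ᵥ x) i = a i) ∧ (∀ i, ∃ x ∈ Q, (G *ᵥ x) i = b i)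

/-- For `P₀` with minimal description `E x = α₀`, `G x ≤ β₀`: the polytope `Q` is a deformation
of `P₀` with deforming vector `(a, b)` with respect to `(E, G)`.  The last condition says that for
each vertex `v` of `P₀`, lying exactly on the facets `F_i`, `i ∈ I`, the intersection of `Q` with
the hyperplanes `⟨g_i, x⟩ = b_i`, `i ∈ I`, is a vertex of `Q`. -/
def IsDeformingVector (E : Matrix κ ι ℝ) (G : Matrix μ ι ℝ) (β₀ : μ → ℝ) (P₀ Q : Set (ι → ℝ))
    (a : κ → ℝ) (b : μ → ℝ) : Prop :=
  IsPolytope Q ∧ IsTightDescription E a G b Q ∧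
    ∀ v ∈ Vert P₀, ∃ w ∈ Vert Q,
      Q ∩ {x | ∀ i, v ∈ boundaryFace P₀ G β₀ i → (G *ᵥ x) i = b i} = {w}

/-- `Q` is a deformation of `P₀` (where `E x = α₀`, `G x ≤ β₀` is a minimal description
of `P₀`). -/
def IsDeformation (E : Matrix κ ι ℝ) (G : Matrix μ ι ℝ) (β₀ : μ → ℝ)
    (P₀ Q : Set (ι → ℝ)) : Prop :=
  ∃ (a : κ → ℝ) (b : μ → ℝ), IsDeformingVector E G β₀ P₀ Q a b

/-- The deformation cone of `P₀` with respect to `(E, G)`: the collection of all deforming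
vectors. -/
def deformationCone (E : Matrix κ ι ℝ) (G : Matrix μ ι ℝ) (β₀ : μ → ℝ)
    (P₀ : Set (ι → ℝ)) : Set ((κ → ℝ) × (μ → ℝ)) :=
  {p | ∃ Q : Set (ι → ℝ), IsDeformingVector E G β₀ P₀ Q p.1 p.2}

end Deform

/-! ### Tesler polytopes -/

namespace Tesler

/-- Positions `(i, j)`, `i ≤ j`, of an upper triangular `n × n` matrix (rows and columns are
numbered from `0`). -/
abbrev Pos (n : ℕ) : Type := {p : Fin n × Fin n // p.1 ≤ p.2}

/-- The positions other than the bottom right corner. -/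
abbrev PosT (n : ℕ) : Type := {e : Pos n // ¬ (e.1.1.val + 1 = n ∧ e.1.2.val + 1 = n)}

/-- `𝕌(n)`: real upper triangular matrices. -/
abbrev U (n : ℕ) : Type := Pos n → ℝ

/-- `𝕌̃(n)`: real upper triangular matrices with the bottom right entry deleted. -/
abbrev UT (n : ℕ) : Type := PosT n → ℝ

/-- The entry `m_{i,j}`; it is `0` below the diagonal. -/
def entry {n : ℕ} (m : U n) (i j : Fin n) : ℝ := if h : i ≤ j then m ⟨(i, j), h⟩ else 0

/-- The `i`-th hook sum `m_{i,i} + ∑_{j > i} m_{i,j} - ∑_{j < i} m_{j,i}`. -/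
def hookSum {n : ℕ} (m : U n) (i : Fin n) : ℝ :=
  entry m i i + ∑ j ∈ Finset.Ioi i, entry m i j - ∑ j ∈ Finset.Iio i, entry m j i

theorem entry_add {n : ℕ} (m m' : U n) (i j : Fin n) :
    entry (m + m') i j = entry m i j + entry m' i j := by
  unfold entry; split_ifs <;> simp

theorem entry_smul {n : ℕ} (c : ℝ) (m : U n) (i j : Fin n) :
    entry (c • m) i j = c * entry m i j := by
  unfold entry; split_ifs <;> simp

/-- The hook sum vector `η`, as a linear map. -/
def eta (n : ℕ) : U n →ₗ[ℝ] (Fin n → ℝ) where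
  toFun m i := hookSum m i
  map_add' m m' := by
    funext i
    simp only [hookSum, entry_add, Finset.sum_add_distrib, Pi.add_apply]
    ring
  map_smul' c m := by
    funext i
    simp only [hookSum, entry_smul, ← Finset.mul_sum, Pi.smul_apply, smul_eq_mul,
      RingHom.id_apply]
    ring

/-- The projection `ψ` deleting the bottom right entry. -/
def psi (n : ℕ) : U n →ₗ[ℝ] UT n where
  toFun m e := m e.1
  map_add' _ _ := rfl
  map_smul' _ _ := rfl

/-- The matrix `L_n` of the hook sum map. -/
def L (n : ℕ) : Matrix (Fin n) (Pos n) ℝ := LinearMap.toMatrix' (eta n)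

/-- The matrix `P_n` of the projection `ψ`. -/
def P (n : ℕ) : Matrix (PosT n) (Pos n) ℝ := LinearMap.toMatrix' (psi n)

/-- The Tesler polytope of hook sum `a` (used for `a` with non-negative entries). -/
def Tes {n : ℕ} (a : Fin n → ℝ) : Set (U n) :=
  {m | (∀ i, hookSum m i = a i) ∧ ∀ e, 0 ≤ m e}

/-- Completes `b` by a bottom right entry `0`.  The hook sums other than the last one do not
involve the bottom right entry, so for them this choice is immaterial. -/
def complete {n : ℕ} (b : UT n) : U n :=
  fun e => if h : ¬ (e.1.1.val + 1 = n ∧ e.1.2.val + 1 = n) then b ⟨e, h⟩ else 0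

/-- The hook sum `η_i(b)` of `b ∈ 𝕌̃(n)`, used for `i` other than the last index. -/
def hookSumT {n : ℕ} (b : UT n) (i : Fin n) : ℝ := hookSum (complete b) i

end Tesler

end

/-! A matrix with hook sums `a` is a flow: `a i` enters at `i`, the entry `(i, j)` moves from `i` to
`j > i`, and the diagonal entry leaves the network. Sending everything at `r` to a single target `σ
r ≥ r` gives `route σ a`, the only matrix with these hook sums supported on the graph of `σ`
(`eq_route_of_hookSum_eq`). For positive `a₀`, the support of a vertex is exactly such a graph
(`exists_support_of_mem_vert`), so its facets are the positions off the graph.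

If `η_i(b) ≥ -a i` for all but the last `i`, a translation that absorbs `b` turns the system into
some `Tes a'` with `a' ≥ 0` (`exists_solutionSet_eq_vadd_Tes`); the translated routes are then the
required vertices. Conversely, the diagonal vertex `σ = id` alone forces all the inequalities
(`hookSumT_ge_of_isDeformingVector`). Minimality needs an everywhere positive flow and, for each
constraint, a point violating only that one. -/

-- Slack constraints survive a small step by continuity, the others because the direction does not
-- move them; finiteness gives a common step length.
open Filter Topology in
theorem exists_pos_forall_add_mul_le {μ : Type*} [Finite μ] {c d β : μ → ℝ}
    (h : ∀ k, c k < β k ∨ (c k ≤ β k ∧ d k = 0)) : ∃ ε : ℝ, 0 < ε ∧ ∀ k, c k + ε * d k ≤ β k := by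
  have key : ∀ᶠ ε : ℝ in 𝓝[>] 0, ∀ k, c k + ε * d k ≤ β k := by
    rw [eventually_all]
    intro k
    rcases h k with hk | ⟨hk, hd⟩
    · have ht : Tendsto (fun ε : ℝ => c k + ε * d k) (𝓝[>] 0) (𝓝 (c k + 0 * d k)) :=
        (Continuous.tendsto (by fun_prop) 0).mono_left nhdsWithin_le_nhds
      filter_upwards [ht.eventually (gt_mem_nhds (by simpa using hk))] with ε hε using hε.le
    · exact Eventually.of_forall fun ε => by simpa [hd] using hk
  obtain ⟨ε, hε, h0⟩ := (key.and self_mem_nhdsWithin).exists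
  exact ⟨ε, h0, hε⟩

theorem le_vectorSpan_of_forall_exists {V : Type*} [AddCommGroup V] [Module ℝ V] {S : Set V}
    {K : Submodule ℝ V} {x : V} (hx : x ∈ S) (h : ∀ v ∈ K, ∃ ε : ℝ, 0 < ε ∧ x + ε • v ∈ S) :
    K ≤ vectorSpan ℝ S := by
  intro v hv
  obtain ⟨ε, hε, hm⟩ := h v hv
  have := vsub_mem_vectorSpan ℝ hm hx
  rw [vsub_eq_sub, add_sub_cancel_left] at this
  exact (Submodule.smul_mem_iff _ hε.ne').1 this

theorem finrank_inf_ker_add_one {V : Type*} [AddCommGroup V] [Module ℝ V] [FiniteDimensional ℝ V]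
    (K : Submodule ℝ V) (φ : V →ₗ[ℝ] ℝ) {u : V} (hu : u ∈ K) (hφ : φ u ≠ 0) :
    Module.finrank ℝ (K ⊓ LinearMap.ker φ : Submodule ℝ V) + 1 = Module.finrank ℝ K := by
  have hsurj : Function.Surjective (φ.domRestrict K) := fun c =>
    ⟨(c / φ u) • ⟨u, hu⟩, by simp [hφ]⟩
  have h1 := (φ.domRestrict K).finrank_range_add_finrank_ker
  rw [LinearMap.range_eq_top.2 hsurj, finrank_top, Module.finrank_self,
    LinearMap.ker_domRestrict] at h1
  rw [← Submodule.map_comap_subtype, Submodule.finrank_map_subtype_eq, ← h1, add_comm]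

/-! ### Minimal descriptions and vertices of general linear systems. -/

namespace Deform

variable {ι κ μ : Type*} [Fintype ι]

theorem isPolyhedron_solutionSet [Finite κ] [Finite μ] (E : Matrix κ ι ℝ) (a : κ → ℝ)
    (G : Matrix μ ι ℝ) (b : μ → ℝ) : IsPolyhedron (solutionSet E a G b) := by
  classical
  cases nonempty_fintype κ
  cases nonempty_fintype μ
  refine ⟨(Finset.univ.image fun k => (E k, a k)) ∪ (Finset.univ.image fun k => (-E k, -a k)) ∪
    Finset.univ.image fun k => (G k, b k), ?_⟩
  ext x
  simp only [Set.mem_ofPred_eq, Finset.mem_union, Finset.mem_image, Finset.mem_univ, true_and]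
  constructor
  · rintro ⟨h1, h2⟩ c ((⟨k, rfl⟩ | ⟨k, rfl⟩) | ⟨k, rfl⟩)
    · exact (congrFun h1 k).le
    · rw [neg_dotProduct]
      exact neg_le_neg (congrFun h1 k).ge
    · exact h2 k
  · intro h
    refine ⟨funext fun k => le_antisymm (h _ (Or.inl (Or.inl ⟨k, rfl⟩))) ?_,
      fun k => h _ (Or.inr ⟨k, rfl⟩)⟩
    have := h _ (Or.inl (Or.inr ⟨k, rfl⟩))
    rw [neg_dotProduct] at this
    exact neg_le_neg_iff.1 this

section MinimalDescription

variable {E : Matrix κ ι ℝ} {α : κ → ℝ} {G : Matrix μ ι ℝ} {β : μ → ℝ}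

theorem vectorSpan_le_ker {P : Set (ι → ℝ)} (h : ∀ x ∈ P, E *ᵥ x = α) :
    vectorSpan ℝ P ≤ LinearMap.ker E.mulVecLin := by
  refine Submodule.span_le.2 ?_
  rintro _ ⟨x, hx, y, hy, rfl⟩
  simp [Matrix.mulVec_sub, h x hx, h y hy]

theorem vectorSpan_solutionSet [Finite μ] {x₀ : ι → ℝ} (h₀ : E *ᵥ x₀ = α)
    (hlt : ∀ k, (G *ᵥ x₀) k < β k) :
    vectorSpan ℝ (solutionSet E α G β) = LinearMap.ker E.mulVecLin := by
  refine le_antisymm (vectorSpan_le_ker fun x hx => hx.1)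
    (le_vectorSpan_of_forall_exists (x := x₀) ⟨h₀, fun k => (hlt k).le⟩ fun v hv => ?_)
  obtain ⟨ε, hε, h⟩ := exists_pos_forall_add_mul_le (d := G *ᵥ v) fun k => Or.inl (hlt k)
  have hv' : E *ᵥ v = 0 := hv
  exact ⟨ε, hε, by simp [Matrix.mulVec_add, Matrix.mulVec_smul, h₀, hv'],
    fun k => by simpa [Matrix.mulVec_add, Matrix.mulVec_smul] using h k⟩

/-- At `z` only the `i`-th inequality is tight, so every direction preserving it and the equalities
can be followed a little way inside the face. -/
theorem vectorSpan_solutionSet_inter [Finite μ] {i : μ} {z : ι → ℝ} (hz : E *ᵥ z = α)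
    (hi : (G *ᵥ z) i = β i) (hlt : ∀ k, k ≠ i → (G *ᵥ z) k < β k) :
    vectorSpan ℝ {x ∈ solutionSet E α G β | (G *ᵥ x) i = β i} =
      LinearMap.ker E.mulVecLin ⊓ LinearMap.ker (LinearMap.proj i ∘ₗ G.mulVecLin) := by
  have hz' : G *ᵥ z ≤ β := fun k => by
    by_cases hk : k = i
    · rw [hk, hi]
    · exact (hlt k hk).le
  refine le_antisymm (le_inf (vectorSpan_le_ker fun x hx => hx.1.1) ?_)
    (le_vectorSpan_of_forall_exists (x := z) ⟨⟨hz, hz'⟩, hi⟩ ?_)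
  · refine Submodule.span_le.2 ?_
    rintro _ ⟨x, hx, y, hy, rfl⟩
    simp [Matrix.mulVec_sub, hx.2, hy.2]
  · rintro v ⟨hv : E *ᵥ v = 0, hv' : (G *ᵥ v) i = 0⟩
    obtain ⟨ε, hε, h⟩ := exists_pos_forall_add_mul_le (c := G *ᵥ z) (d := G *ᵥ v) (β := β)
      fun k => by
        by_cases hk : k = i
        · subst hk
          exact Or.inr ⟨hi.le, hv'⟩
        · exact Or.inl (hlt k hk)
    exact ⟨ε, hε, ⟨by simp [Matrix.mulVec_add, Matrix.mulVec_smul, hz, hv],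
      fun k => by simpa [Matrix.mulVec_add, Matrix.mulVec_smul] using h k⟩,
      by simp [Matrix.mulVec_add, Matrix.mulVec_smul, hi, hv']⟩

/-- The segment from `x₀` to `y` crosses the `i`-th hyperplane, and the crossing point inherits
strictness in the other inequalities from `x₀`. -/
theorem exists_mem_facet {x₀ y : ι → ℝ} {i : μ} (h₀ : E *ᵥ x₀ = α)
    (hlt : ∀ k, (G *ᵥ x₀) k < β k) (hy : E *ᵥ y = α) (hi : β i < (G *ᵥ y) i)
    (hle : ∀ k, k ≠ i → (G *ᵥ y) k ≤ β k) :
    ∃ z, E *ᵥ z = α ∧ (G *ᵥ z) i = β i ∧ ∀ k, k ≠ i → (G *ᵥ z) k < β k := by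
  have h1 : 0 < (G *ᵥ y) i - β i := sub_pos.2 hi
  have h2 : 0 < β i - (G *ᵥ x₀) i := sub_pos.2 (hlt i)
  set p := (G *ᵥ y) i - β i with hp
  set q := β i - (G *ᵥ x₀) i with hq
  have hpq : 0 < p + q := by positivity
  refine ⟨(p / (p + q)) • x₀ + (q / (p + q)) • y, ?_, ?_, fun k hk => ?_⟩
  · rw [Matrix.mulVec_add, Matrix.mulVec_smul, Matrix.mulVec_smul, h₀, hy, ← add_smul,
      ← add_div, div_self hpq.ne', one_smul]
  · simp only [Matrix.mulVec_add, Matrix.mulVec_smul, Pi.add_apply, Pi.smul_apply, smul_eq_mul]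
    field_simp
    rw [hp, hq]
    ring
  · simp only [Matrix.mulVec_add, Matrix.mulVec_smul, Pi.add_apply, Pi.smul_apply, smul_eq_mul]
    calc _ < p / (p + q) * β k + q / (p + q) * β k :=
          add_lt_add_of_lt_of_le (mul_lt_mul_of_pos_left (hlt k) (by positivity))
            (mul_le_mul_of_nonneg_left (hle k hk) (by positivity))
      _ = β k := by field_simp

/-- A system is a minimal description of its bounded solution set if it has a solution that
satisfies all inequalities strictly, and every single constraint is violated by a point that
satisfies all the others. -/
theorem isMinimalDescription_of_exists [Finite κ] [Finite μ]
    (hbdd : Bornology.IsBounded (solutionSet E α G β))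
    {x₀ : ι → ℝ} (h₀ : E *ᵥ x₀ = α) (hlt : ∀ k, (G *ᵥ x₀) k < β k)
    (hG : ∀ i, ∃ y, E *ᵥ y = α ∧ β i < (G *ᵥ y) i ∧ ∀ k, k ≠ i → (G *ᵥ y) k ≤ β k)
    (hE : ∀ i, ∃ y, (∀ k, k ≠ i → (E *ᵥ y) k = α k) ∧ (E *ᵥ y) i ≠ α i ∧ G *ᵥ y ≤ β) :
    IsMinimalDescription E α G β (solutionSet E α G β) where
  isPolytope := ⟨isPolyhedron_solutionSet E α G β, hbdd⟩
  eq_solutionSet := rfl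
  affineSpan_eq := by
    have hx₀ : x₀ ∈ affineSpan ℝ (solutionSet E α G β) :=
      subset_affineSpan ℝ _ ⟨h₀, fun k => (hlt k).le⟩
    ext y
    rw [SetLike.mem_coe, ← AffineSubspace.vsub_right_mem_direction_iff_mem hx₀,
      direction_affineSpan, vectorSpan_solutionSet h₀ hlt]
    simp [Matrix.mulVec_sub, h₀, sub_eq_zero]
  definesFacet i := by
    obtain ⟨y, hy, hi, hle⟩ := hG i
    obtain ⟨z, hz, hzi, hzlt⟩ := exists_mem_facet h₀ hlt hy hi hle
    refine ⟨fun x hx => hx.2 i, ⟨z, ⟨hz, fun k => ?_⟩, hzi⟩, ?_⟩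
    · by_cases hk : k = i
      · rw [hk, hzi]
      · exact (hzlt k hk).le
    · rw [vectorSpan_solutionSet h₀ hlt]
      refine Eq.trans ?_ (finrank_inf_ker_add_one (LinearMap.ker E.mulVecLin)
        (LinearMap.proj i ∘ₗ G.mulVecLin) (u := y - x₀) ?_ ?_)
      · rw [← vectorSpan_solutionSet_inter hz hzi hzlt]
        rfl
      · simp [Matrix.mulVec_sub, h₀, hy]
      · have := (hlt i).trans hi
        simpa [Matrix.mulVec_sub, sub_eq_zero] using this.ne'
  eq_irredundant i h := by
    obtain ⟨y, hy, hne, hle⟩ := hE i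
    have hm : y ∈ solutionSet E α G β := h ▸ ⟨hy, hle⟩
    exact hne (congrFun hm.1 i)
  le_irredundant i h := by
    obtain ⟨y, hy, hi, hle⟩ := hG i
    have hm : y ∈ solutionSet E α G β := h ▸ ⟨hy, hle⟩
    exact hi.not_ge (hm.2 i)

end MinimalDescription

/-- A point cut out of a solution set by turning some of the inequalities into equalities is a
vertex. -/
theorem mem_vert_of_inter_eq_singleton {E : Matrix κ ι ℝ} {a : κ → ℝ} {G : Matrix μ ι ℝ}
    {b : μ → ℝ} {I : μ → Prop} {w : ι → ℝ}
    (h : solutionSet E a G b ∩ {x | ∀ i, I i → (G *ᵥ x) i = b i} = {w}) :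
    w ∈ Vert (solutionSet E a G b) := by
  have hw := h.ge rfl
  refine mem_extremePoints.2 ⟨hw.1, fun x hx y hy hxy => ?_⟩
  obtain ⟨s, t, hs, ht, hst, hw'⟩ := hxy
  have key : ∀ i, I i → (G *ᵥ x) i = b i ∧ (G *ᵥ y) i = b i := by
    intro i hi
    have h1 := hw.2 i hi
    rw [← hw'] at h1
    simp only [Matrix.mulVec_add, Matrix.mulVec_smul, Pi.add_apply, Pi.smul_apply,
      smul_eq_mul] at h1
    have hxi := hx.2 i
    have hyi := hy.2 i
    obtain rfl : t = 1 - s := by linarith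
    -- Two numbers at most `b i` whose average with positive weights is `b i` both equal `b i`.
    constructor <;> nlinarith
  exact ⟨h.le ⟨hx, fun i hi => (key i hi).1⟩, h.le ⟨hy, fun i hi => (key i hi).2⟩⟩

end Deform

/-! ### Hook sums and the Tesler system. -/

namespace Tesler

variable {n : ℕ}

theorem L_mulVec (m : U n) (i : Fin n) : (L n *ᵥ m) i = hookSum m i :=
  congrFun (LinearMap.toMatrix'_mulVec (eta n) m) i

theorem neg_P_mulVec (m : U n) (e : PosT n) : (-P n *ᵥ m) e = -m e.1 := by
  rw [Matrix.neg_mulVec, Pi.neg_apply]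
  exact congrArg Neg.neg (congrFun (LinearMap.toMatrix'_mulVec (psi n) m) e)

theorem mem_solutionSet {a : Fin n → ℝ} {b : UT n} {m : U n} :
    m ∈ Deform.solutionSet (L n) a (-P n) b ↔
      (∀ i, hookSum m i = a i) ∧ ∀ e : PosT n, -m e.1 ≤ b e := by
  simp only [Deform.solutionSet, Set.mem_ofPred_eq, funext_iff, Pi.le_def, L_mulVec, neg_P_mulVec]

theorem hookSum_add (m m' : U n) (i : Fin n) :
    hookSum (m + m') i = hookSum m i + hookSum m' i :=
  congrFun ((eta n).map_add m m') i

theorem hookSum_neg (m : U n) (i : Fin n) : hookSum (-m) i = -hookSum m i :=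
  congrFun ((eta n).map_neg m) i

theorem hookSum_sub (m m' : U n) (i : Fin n) :
    hookSum (m - m') i = hookSum m i - hookSum m' i :=
  congrFun ((eta n).map_sub m m') i

theorem hookSum_smul (c : ℝ) (m : U n) (i : Fin n) : hookSum (c • m) i = c * hookSum m i :=
  congrFun ((eta n).map_smul c m) i

theorem entry_of_le (m : U n) {i j : Fin n} (h : i ≤ j) : entry m i j = m ⟨(i, j), h⟩ :=
  dif_pos h

theorem entry_of_lt (m : U n) {i j : Fin n} (h : j < i) : entry m i j = 0 :=
  dif_neg h.not_ge

theorem entry_pos (m : U n) (e : Pos n) : entry m e.1.1 e.1.2 = m e :=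
  entry_of_le m e.2

theorem entry_nonneg {m : U n} (hm : ∀ e, 0 ≤ m e) (i j : Fin n) : 0 ≤ entry m i j := by
  unfold entry
  split_ifs
  exacts [hm _, le_rfl]

theorem hookSum_eq_sum_sub_sum (m : U n) (i : Fin n) :
    hookSum m i = ∑ j, entry m i j - ∑ j ∈ Finset.Iio i, entry m j i := by
  rw [hookSum, ← Finset.sum_insert (by simp), Finset.Ioi_insert]
  congr 1
  exact Finset.sum_subset (Finset.subset_univ _) fun j _ hj =>
    entry_of_lt m (by simpa using hj)

theorem hookSum_single (e : Pos n) (i : Fin n) :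
    hookSum (Pi.single e 1) i =
      (if i = e.1.1 then 1 else 0) - if i = e.1.2 ∧ e.1.1 < e.1.2 then 1 else 0 := by
  obtain ⟨⟨r, c⟩, hrc⟩ := e
  have he : ∀ i j, entry (Pi.single ⟨(r, c), hrc⟩ 1 : U n) i j =
      if i = r ∧ j = c then 1 else 0 := by
    intro i j
    unfold entry
    by_cases h : i = r ∧ j = c
    · obtain ⟨rfl, rfl⟩ := h
      simp [show i ≤ j from hrc]
    · rw [if_neg h]
      split_ifs
      · exact Pi.single_eq_of_ne (by simpa using h) _
      · rfl
  rw [hookSum_eq_sum_sub_sum]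
  simp only [he]
  congr 1
  · by_cases h : i = r <;> simp [h]
  · by_cases h : i = c
    · subst h
      simp
    · simp [h]

/-- The last hook sum expresses the corner entry as `a` at the last index plus the entries above it,
so its nonnegativity follows from the rest. This is why `ψ` drops the corner. -/
theorem nonneg_of_forall_posT_nonneg {a : Fin n → ℝ} (ha : ∀ i, 0 ≤ a i) {m : U n}
    (h : ∀ i, hookSum m i = a i) (hm : ∀ e : PosT n, 0 ≤ m e.1) (e : Pos n) : 0 ≤ m e := by
  by_cases he : e.1.1.val + 1 = n ∧ e.1.2.val + 1 = n
  · obtain ⟨⟨r, c⟩, hrc⟩ := e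
    obtain rfl : r = c := Fin.ext (by have := he.1; have := he.2; simp only at *; omega)
    have h1 := h r
    have hIoi : Finset.Ioi r = ∅ := by
      ext j
      simp only [Finset.mem_Ioi, Finset.notMem_empty, iff_false, Fin.lt_def]
      have := he.1
      simp only at this
      omega
    have h2 : 0 ≤ ∑ j ∈ Finset.Iio r, entry m j r := Finset.sum_nonneg fun j hj => by
      have hj' := Finset.mem_Iio.1 hj
      rw [entry_of_le m hj'.le]
      refine hm ⟨_, ?_⟩
      have := Fin.lt_def.1 hj'
      simp only
      omega
    rw [hookSum, hIoi, Finset.sum_empty, entry_of_le m le_rfl] at h1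
    linarith [ha r]
  · exact hm ⟨e, he⟩

theorem Tes_eq_solutionSet {a : Fin n → ℝ} (ha : ∀ i, 0 ≤ a i) :
    Tes a = Deform.solutionSet (L n) a (-P n) 0 := by
  ext m
  rw [mem_solutionSet]
  refine and_congr_right fun h => ⟨fun hm e => by simpa using hm e.1, fun hm => ?_⟩
  exact nonneg_of_forall_posT_nonneg ha h fun e => by simpa using hm e

/-! ### Flows -/

/-- The total flow through each vertex, when `a r` enters at `r` and each vertex `s` passes on to
`r > s` the fraction `p s r` of the flow through it. -/
noncomputable def throughput (p : Fin n → Fin n → ℝ) (a : Fin n → ℝ) (r : Fin n) : ℝ :=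
  a r + ∑ s : Finset.Iio r, p s.1 r * throughput p a s.1
termination_by r.val
decreasing_by exact Fin.lt_def.1 (Finset.mem_Iio.1 s.2)

theorem throughput_eq (p : Fin n → Fin n → ℝ) (a : Fin n → ℝ) (r : Fin n) :
    throughput p a r = a r + ∑ s ∈ Finset.Iio r, p s r * throughput p a s := by
  rw [throughput, Finset.sum_coe_sort (Finset.Iio r) fun s => p s r * throughput p a s]

theorem throughput_nonneg {p : Fin n → Fin n → ℝ} (hp : ∀ r c, 0 ≤ p r c) {a : Fin n → ℝ}
    (ha : ∀ i, 0 ≤ a i) (r : Fin n) : 0 ≤ throughput p a r := by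
  induction r using WellFoundedLT.induction with
  | ind r ih =>
    rw [throughput_eq]
    exact add_nonneg (ha r) (Finset.sum_nonneg fun s hs =>
      mul_nonneg (hp _ _) (ih s (Finset.mem_Iio.1 hs)))

theorem le_throughput {p : Fin n → Fin n → ℝ} (hp : ∀ r c, 0 ≤ p r c) {a : Fin n → ℝ}
    (ha : ∀ i, 0 ≤ a i) (r : Fin n) : a r ≤ throughput p a r := by
  rw [throughput_eq]
  exact le_add_of_nonneg_right (Finset.sum_nonneg fun s _ =>
      mul_nonneg (hp _ _) (throughput_nonneg hp ha s))

/-- The upper triangular matrix whose `r`-th row distributes the flow through `r` according to the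
weights `p r`. -/
noncomputable def flow (p : Fin n → Fin n → ℝ) (a : Fin n → ℝ) : U n :=
  fun e => p e.1.1 e.1.2 * throughput p a e.1.1

theorem hookSum_flow {p : Fin n → Fin n → ℝ} (hp : ∀ r c, c < r → p r c = 0)
    (hsum : ∀ r, ∑ c, p r c = 1) (a : Fin n → ℝ) (i : Fin n) : hookSum (flow p a) i = a i := by
  have he : ∀ r c, entry (flow p a) r c = p r c * throughput p a r := by
    intro r c
    rcases le_or_gt r c with h | h
    · exact entry_of_le _ h
    · rw [entry_of_lt _ h, hp r c h, zero_mul]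
  simp only [hookSum_eq_sum_sub_sum, he, ← Finset.sum_mul, hsum, one_mul]
  rw [throughput_eq p a i]
  ring

/-- The flow with hook sums `a` in which everything passing through `r` moves on to `σ r`. -/
noncomputable def route (σ : Fin n → Fin n) (a : Fin n → ℝ) : U n :=
  flow (fun r c => if c = σ r then 1 else 0) a

section Route

variable {σ : Fin n → Fin n} {a : Fin n → ℝ}

theorem hookSum_route (hσ : ∀ r, r ≤ σ r) (a : Fin n → ℝ) (i : Fin n) :
    hookSum (route σ a) i = a i :=
  hookSum_flow (fun r _ h => if_neg (h.trans_le (hσ r)).ne) (fun r => by simp) a i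

theorem route_eq_zero {e : Pos n} (h : e.1.2 ≠ σ e.1.1) (a : Fin n → ℝ) : route σ a e = 0 := by
  simp [route, flow, h]

theorem route_nonneg (ha : ∀ i, 0 ≤ a i) (e : Pos n) : 0 ≤ route σ a e := by
  have hp : ∀ r c : Fin n, (0 : ℝ) ≤ if c = σ r then 1 else 0 := fun r c => by split_ifs <;> simp
  exact mul_nonneg (hp _ _) (throughput_nonneg hp ha _)

theorem route_mem_Tes (hσ : ∀ r, r ≤ σ r) (ha : ∀ i, 0 ≤ a i) : route σ a ∈ Tes a :=
  ⟨hookSum_route hσ a, route_nonneg ha⟩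

/-- A matrix supported on the graph of `σ` is determined by its hook sums. -/
theorem eq_route_of_hookSum_eq (hσ : ∀ r, r ≤ σ r) {m : U n} (h : ∀ i, hookSum m i = a i)
    (hm : ∀ e : Pos n, e.1.2 ≠ σ e.1.1 → m e = 0) : m = route σ a := by
  rw [← sub_eq_zero]
  set u := m - route σ a with hu
  have h0 : ∀ i, hookSum u i = 0 := fun i => by rw [hu, hookSum_sub, h, hookSum_route hσ, sub_self]
  have hu0 : ∀ r c, c ≠ σ r → entry u r c = 0 := by
    intro r c hc
    rcases le_or_gt r c with hrc | hrc
    · rw [entry_of_le _ hrc, hu, Pi.sub_apply, hm _ hc, route_eq_zero hc, sub_self]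
    · exact entry_of_lt _ hrc
  -- Once the earlier rows vanish, the hook sum of row `r` reduces to its single entry at `σ r`.
  have key : ∀ r c, entry u r c = 0 := by
    intro r
    induction r using WellFoundedLT.induction with
    | ind r ih =>
      intro c
      by_cases hc : c = σ r
      · have := h0 r
        rwa [hookSum_eq_sum_sub_sum, Finset.sum_eq_zero fun s hs => ih s (Finset.mem_Iio.1 hs) r,
          Finset.sum_eq_single (σ r) (fun c _ hc => hu0 r c hc) (by simp), sub_zero, ← hc] at this
      · exact hu0 r c hc
  exact funext fun e => by rw [← entry_pos u e, key]; rfl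

end Route

/-- The flow that distributes equal shares to all vertices `c ≥ r` is positive everywhere. -/
theorem exists_mem_Tes_forall_pos {a : Fin n → ℝ} (ha : ∀ i, 0 < a i) :
    ∃ m : U n, (∀ i, hookSum m i = a i) ∧ ∀ e, 0 < m e := by
  set p : Fin n → Fin n → ℝ := fun r c => if r ≤ c then ((Finset.Ici r).card : ℝ)⁻¹ else 0
  have hcard : ∀ r : Fin n, 0 < ((Finset.Ici r).card : ℝ) := fun r =>
    Nat.cast_pos.2 (Finset.card_pos.2 ⟨r, by simp⟩)
  have hp0 : ∀ r c, 0 ≤ p r c := fun r c => by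
    unfold p
    split_ifs
    exacts [(inv_pos.2 (hcard r)).le, le_rfl]
  refine ⟨flow p a, hookSum_flow (fun r c h => if_neg h.not_ge) (fun r => ?_) a, fun e => ?_⟩
  · rw [← Finset.sum_filter, Finset.sum_const, nsmul_eq_mul,
      show Finset.univ.filter (fun c => r ≤ c) = Finset.Ici r by ext; simp,
      mul_inv_cancel₀ (hcard r).ne']
  · have : 0 < p e.1.1 e.1.2 := by
      unfold p
      rw [if_pos e.2]
      exact inv_pos.2 (hcard _)
    exact mul_pos this ((ha _).trans_le (le_throughput hp0 (fun i => (ha i).le) _))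

/-- An entry is at most its row total, which is `a r` plus the inflow from earlier rows; with all
weights `1`, `throughput` obeys the resulting recursive bound. -/
theorem entry_le_throughput {a : Fin n → ℝ} {m : U n} (hm : m ∈ Tes a) (r c : Fin n) :
    entry m r c ≤ throughput (fun _ _ => 1) a r := by
  induction r using WellFoundedLT.induction generalizing c with
  | ind r ih =>
    have h := hm.1 r
    rw [hookSum_eq_sum_sub_sum] at h
    have h1 : ∑ s ∈ Finset.Iio r, entry m s r ≤
        ∑ s ∈ Finset.Iio r, 1 * throughput (fun _ _ => 1) a s :=
      Finset.sum_le_sum fun s hs => by simpa using ih s (Finset.mem_Iio.1 hs) r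
    have h2 := Finset.single_le_sum (fun j _ => entry_nonneg hm.2 r j) (Finset.mem_univ c)
    rw [throughput_eq]
    linarith

theorem isBounded_Tes (a : Fin n → ℝ) : Bornology.IsBounded (Tes a) := by
  refine (Metric.isBounded_Icc (0 : U n)
    fun e => throughput (fun _ _ => 1) a e.1.1).subset fun m hm => ⟨hm.2, fun e => ?_⟩
  rw [← entry_pos m e]
  exact entry_le_throughput hm _ _

/-! ### The minimal description -/

/-- For every position other than the last one there is a choice of routes that avoids it. -/
theorem exists_route_avoiding (e : PosT n) : ∃ σ : Fin n → Fin n, (∀ r, r ≤ σ r) ∧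
    e.1.1.2 ≠ σ e.1.1.1 := by
  obtain ⟨⟨⟨r, c⟩, hrc⟩, he⟩ := e
  -- The identity avoids off-diagonal positions; sending everything to the last index avoids the
  -- diagonal ones other than the corner.
  rcases hrc.lt_or_eq with h | h
  · exact ⟨id, fun _ => le_rfl, h.ne'⟩
  · change r = c at h
    subst h
    have hr := r.2
    refine ⟨fun _ => ⟨n - 1, by omega⟩, fun s => Fin.le_def.2 (Nat.le_sub_one_of_lt s.2),
      fun h => ?_⟩
    have h1 : r.val = n - 1 := congrArg Fin.val h
    have h2 : r.val + 1 = n := by omega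
    exact he ⟨h2, h2⟩

theorem isMinimalDescription_Tes {a₀ : Fin n → ℝ} (ha₀ : ∀ i, 0 < a₀ i) :
    Deform.IsMinimalDescription (L n) a₀ (-P n) 0 (Tes a₀) := by
  have ha := fun i => (ha₀ i).le
  obtain ⟨x₀, hx₀, hpos⟩ := exists_mem_Tes_forall_pos ha₀
  rw [Tes_eq_solutionSet ha]
  refine Deform.isMinimalDescription_of_exists (x₀ := x₀) ?_
    (funext fun i => by rw [L_mulVec, hx₀])
    (fun e => by rw [neg_P_mulVec]; exact neg_neg_of_pos (hpos e.1)) (fun e => ?_) fun i => ?_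
  · rw [← Tes_eq_solutionSet ha]
    exact isBounded_Tes a₀
  · obtain ⟨σ, hσ, hne⟩ := exists_route_avoiding e
    set d := a₀ e.1.1.2
    have hd : 0 < d := ha₀ _
    -- The hook sums are corrected so that subtracting `d` at `e` restores `a₀`. A unit at `e`
    -- lowers a hook sum only at the column index, where `a₀` equals `d`, so `a'` stays nonnegative.
    set a' : Fin n → ℝ := fun i => a₀ i + d * hookSum (Pi.single e.1 1) i with ha'
    have ha'0 : ∀ i, 0 ≤ a' i := by
      intro i
      simp only [ha', hookSum_single]
      by_cases hi : i = e.1.1.2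
      · have : a₀ i = d := by rw [hi]
        split_ifs <;> simp [this, hd.le]
      · rw [if_neg (not_and_of_not_left _ hi)]
        have := ha i
        split_ifs <;> simp only [sub_zero, mul_one, mul_zero] <;> linarith
    refine ⟨route σ a' - d • Pi.single e.1 1, funext fun i => ?_, ?_, fun k hk => ?_⟩
    · rw [L_mulVec, hookSum_sub, hookSum_smul, hookSum_route hσ]
      simp [ha']
    · rw [neg_P_mulVec]
      simp [route_eq_zero hne, hd]
    · rw [neg_P_mulVec]
      have : k.1 ≠ e.1 := fun h => hk (Subtype.ext h)
      simp [Pi.single_eq_of_ne this, route_nonneg ha'0]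
  -- A diagonal entry occurs in one hook sum only, so this breaks just the `i`-th equality.
  · refine ⟨x₀ + Pi.single ⟨(i, i), le_rfl⟩ 1, fun k hk => ?_, ?_, fun e => ?_⟩
    · rw [L_mulVec, hookSum_add, hx₀, hookSum_single]
      simp [hk]
    · rw [L_mulVec, hookSum_add, hx₀, hookSum_single]
      simp
    · rw [neg_P_mulVec]
      have h1 : (0 : ℝ) ≤ (Pi.single ⟨(i, i), le_rfl⟩ 1 : U n) e.1 := by
        rw [Pi.single_apply]
        split_ifs <;> simp
      exact neg_nonpos.2 (add_nonneg (hpos _).le h1)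

/-! ### Vertices -/

/-- A vertex of a Tesler polytope with positive hook sums has one positive entry in each row. -/
theorem exists_support_of_mem_vert {a₀ : Fin n → ℝ} (ha₀ : ∀ i, 0 < a₀ i) {v : U n}
    (hv : v ∈ Deform.Vert (Tes a₀)) :
    ∃ σ : Fin n → Fin n, (∀ r, r ≤ σ r) ∧ ∀ e : Pos n, v e ≠ 0 ↔ e.1.2 = σ e.1.1 := by
  obtain ⟨hvT, hext⟩ := mem_extremePoints.1 hv
  have hex : ∀ r, ∃ c, 0 < entry v r c := by
    intro r
    by_contra! h
    have h1 := hvT.1 r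
    rw [hookSum_eq_sum_sub_sum] at h1
    have h2 := Finset.sum_nonpos fun c (_ : c ∈ Finset.univ) => h c
    have h3 := Finset.sum_nonneg fun s (_ : s ∈ Finset.Iio r) => entry_nonneg hvT.2 s r
    linarith [ha₀ r]
  choose σ hσpos using hex
  have hσ : ∀ r, r ≤ σ r := fun r => by
    by_contra! h
    exact (hσpos r).ne' (entry_of_lt v h)
  refine ⟨σ, hσ, fun e => ⟨fun he => ?_, fun he => ?_⟩⟩
  · by_contra hne
    -- If row `e.1.1` had a second nonzero entry `e`, cancelling the hook sums of a unit at `e` by a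
    -- route along `σ` would give a direction within the support of `v`. Then `v` would be the
    -- midpoint of `v ± ε • u`.
    set u : U n := Pi.single e 1 - route σ (hookSum (Pi.single e 1)) with hu
    have hu0 : ∀ i, hookSum u i = 0 := fun i => by
      rw [hu, hookSum_sub, hookSum_route hσ, sub_self]
    have hue : u e = 1 := by simp [hu, route_eq_zero hne]
    have hsupp : ∀ f, v f = 0 → u f = 0 := by
      intro f hf
      have h1 : f ≠ e := by rintro rfl; exact he hf
      have h2 : f.1.2 ≠ σ f.1.1 := fun h => (hσpos f.1.1).ne' (by rw [← h, entry_pos, hf])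
      simp [hu, Pi.single_eq_of_ne h1, route_eq_zero h2]
    obtain ⟨ε, hε, hle⟩ := exists_pos_forall_add_mul_le (c := fun f => -v f) (d := fun f => |u f|)
      (β := 0) fun f => by
        rcases (hvT.2 f).lt_or_eq with h | h
        · exact Or.inl (neg_neg_of_pos h)
        · exact Or.inr ⟨by simp [← h], by simp [hsupp f h.symm]⟩
    have hmem : ∀ s : ℝ, |s| = ε → v + s • u ∈ Tes a₀ := by
      refine fun s hs => ⟨fun i => by rw [hookSum_add, hookSum_smul, hu0, hvT.1, mul_zero, add_zero],
        fun f => ?_⟩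
      have h1 := hle f
      have h2 := neg_abs_le (s * u f)
      rw [abs_mul, hs] at h2
      simp only [Pi.zero_apply] at h1
      simp only [Pi.add_apply, Pi.smul_apply, smul_eq_mul]
      linarith
    have := (hext _ (hmem ε (abs_of_pos hε)) _ (hmem (-ε) (by rw [abs_neg, abs_of_pos hε]))
      ⟨1 / 2, 1 / 2, by norm_num, by norm_num, by norm_num, by ext f; simp; ring⟩).1
    have := congrFun this e
    simp [hue, hε.ne'] at this
  · rw [← entry_pos v e, he]
    exact (hσpos _).ne'

/-- `σ` fixes the last index, so the corner always lies on its graph and vanishing off the graph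
involves only facet inequalities. -/
theorem not_last_of_ne {σ : Fin n → Fin n} (hσ : ∀ r, r ≤ σ r) {e : Pos n}
    (he : e.1.2 ≠ σ e.1.1) : ¬ (e.1.1.val + 1 = n ∧ e.1.2.val + 1 = n) := by
  rintro ⟨h1, h2⟩
  have h3 := Fin.le_def.1 (hσ e.1.1)
  have h4 := (σ e.1.1).2
  exact he (Fin.ext (by omega))

theorem Tes_inter_eq_singleton {σ : Fin n → Fin n} (hσ : ∀ r, r ≤ σ r)
    {a : Fin n → ℝ} (ha : ∀ i, 0 ≤ a i) :
    Tes a ∩ {x | ∀ e : PosT n, e.1.1.2 ≠ σ e.1.1.1 → x e.1 = 0} = {route σ a} := by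
  refine Set.eq_singleton_iff_unique_mem.2
    ⟨⟨route_mem_Tes hσ ha, fun e he => route_eq_zero he a⟩, fun m hm => ?_⟩
  exact eq_route_of_hookSum_eq hσ hm.1.1 fun e he => hm.2 ⟨e, not_last_of_ne hσ he⟩ he

/-! ### Deformations -/

theorem complete_apply (b : UT n) (e : PosT n) : complete b e.1 = b e := dif_pos e.2

/-- A system with the hook sum condition on its right-hand sides describes a translate of a Tesler
polytope. -/
theorem exists_solutionSet_eq_vadd_Tes {a : Fin n → ℝ} {b : UT n}
    (h : ∀ i : Fin n, i.val + 1 < n → hookSumT b i ≥ -a i) :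
    ∃ a' : Fin n → ℝ, (∀ i, 0 ≤ a' i) ∧ ∃ t : U n, (∀ e : PosT n, t e.1 = -b e) ∧
      Deform.solutionSet (L n) a (-P n) b = t +ᵥ Tes a' := by
  -- The corner of `t` is free; it is chosen so that the last hook sum of the translated system is
  -- `0`.
  obtain ⟨t, ht, htl⟩ : ∃ t : U n, (∀ e : PosT n, t e.1 = -b e) ∧
      ∀ i, a i - hookSum t i = if i.val + 1 < n then a i + hookSumT b i else 0 := by
    rcases n with _ | k
    · exact ⟨0, fun e => e.1.1.1.elim0, fun i => i.elim0⟩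
    · set l : Pos (k + 1) := ⟨(Fin.last k, Fin.last k), le_rfl⟩ with hl
      refine ⟨-complete b + (a (Fin.last k) + hookSum (complete b) (Fin.last k)) • Pi.single l 1,
        fun e => ?_, fun i => ?_⟩
      · have : e.1 ≠ l := fun h => e.2 (by simp [h, hl])
        simp [Pi.single_eq_of_ne this, complete_apply]
      · rw [hookSum_add, hookSum_neg, hookSum_smul, hookSum_single]
        by_cases hi : i = Fin.last k
        · subst hi
          simp [hl]
        · have h1 : i.val + 1 < k + 1 := by
            have := Fin.val_lt_last hi
            omega
          simp [hl, hi, hookSumT]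
          intro h2
          omega
  have ha' : ∀ i, 0 ≤ a i - hookSum t i := fun i => by
    rw [htl]
    split_ifs with hi
    · linarith [h i hi]
    · exact le_rfl
  refine ⟨fun i => a i - hookSum t i, ha', t, ht, ?_⟩
  ext m
  rw [Set.mem_vadd_set_iff_neg_vadd_mem, Tes_eq_solutionSet ha', mem_solutionSet, mem_solutionSet,
    vadd_eq_add]
  refine and_congr (forall_congr' fun i => ?_) (forall_congr' fun e => ?_)
  · rw [hookSum_add, hookSum_neg]
    constructor <;> intro h <;> linarith
  · simp only [Pi.add_apply, Pi.neg_apply, ht, neg_neg, Pi.zero_apply]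
    constructor <;> intro h <;> linarith

theorem isDeformingVector_of_hookSumT_ge {a₀ : Fin n → ℝ} (ha₀ : ∀ i, 0 < a₀ i)
    {a : Fin n → ℝ} {b : UT n} (h : ∀ i : Fin n, i.val + 1 < n → hookSumT b i ≥ -a i) :
    Deform.IsDeformingVector (L n) (-P n) 0 (Tes a₀) (Deform.solutionSet (L n) a (-P n) b) a b := by
  obtain ⟨a', ha', t, ht, hQ⟩ := exists_solutionSet_eq_vadd_Tes h
  have hmem : ∀ {σ : Fin n → Fin n}, (∀ r, r ≤ σ r) →
      t + route σ a' ∈ Deform.solutionSet (L n) a (-P n) b := fun hσ => by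
    rw [hQ]
    exact Set.vadd_mem_vadd_set (route_mem_Tes hσ ha')
  refine ⟨⟨Deform.isPolyhedron_solutionSet _ _ _ _, ?_⟩, ⟨rfl, fun i => ?_, fun e => ?_⟩,
    fun v hv => ?_⟩
  · rw [hQ]
    exact (isBounded_Tes a').vadd t
  · exact ⟨_, hmem (σ := id) fun _ => le_rfl, congrFun (hmem (σ := id) fun _ => le_rfl).1 i⟩
  · obtain ⟨σ, hσ, hne⟩ := exists_route_avoiding e
    exact ⟨_, hmem hσ, by rw [neg_P_mulVec]; simp [ht, route_eq_zero hne]⟩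
  · obtain ⟨σ, hσ, hsupp⟩ := exists_support_of_mem_vert ha₀ hv
    -- The facets through `v` are exactly the positions off the graph of `σ`, so the face condition
    -- cuts out the translated route.
    have hI : ∀ e : PosT n, v ∈ Deform.boundaryFace (Tes a₀) (-P n) 0 e ↔
        e.1.1.2 ≠ σ e.1.1.1 := fun e => by
      rw [← not_iff_not, not_not, ← hsupp]
      simp only [Deform.boundaryFace, Set.mem_ofPred_eq, neg_P_mulVec, Pi.zero_apply, neg_eq_zero,
        hv.1, true_and]
    have hw : Deform.solutionSet (L n) a (-P n) b ∩ {x | ∀ e,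
        v ∈ Deform.boundaryFace (Tes a₀) (-P n) 0 e → (-P n *ᵥ x) e = b e} =
        {t + route σ a'} := by
      rw [hQ, ← vadd_eq_add, ← Set.vadd_set_singleton, ← Tes_inter_eq_singleton hσ ha',
        Set.vadd_set_inter]
      congr 1
      ext x
      simp only [hI, neg_P_mulVec, Set.mem_vadd_set_iff_neg_vadd_mem, Set.mem_ofPred_eq,
        vadd_eq_add, Pi.add_apply, Pi.neg_apply, ht, neg_neg]
      refine forall_congr' fun e => imp_congr_right fun _ => ?_
      constructor <;> intro h <;> linarith
    exact ⟨_, Deform.mem_vert_of_inter_eq_singleton hw, hw⟩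

theorem diagonal_mem_vert {a₀ : Fin n → ℝ} (ha₀ : ∀ i, 0 ≤ a₀ i) :
    route id a₀ ∈ Deform.Vert (Tes a₀) := by
  have h := Tes_inter_eq_singleton (σ := id) (fun _ => le_rfl) ha₀
  rw [Tes_eq_solutionSet ha₀] at h ⊢
  refine Deform.mem_vert_of_inter_eq_singleton (I := fun e => e.1.1.2 ≠ id e.1.1.1) ?_
  simpa only [neg_P_mulVec, Pi.zero_apply, neg_eq_zero] using h

/-- Let `w` be the point of `Q` matching the diagonal vertex. Then `w + complete b` is zero off the
diagonal, so its `i`-th hook sum `a i + hookSumT b i` is its diagonal entry, which is nonnegative by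
the inequality at `(i, i)`. -/
theorem hookSumT_ge_of_isDeformingVector {a₀ : Fin n → ℝ} (ha₀ : ∀ i, 0 ≤ a₀ i)
    {Q : Set (U n)} {a : Fin n → ℝ} {b : UT n}
    (h : Deform.IsDeformingVector (L n) (-P n) 0 (Tes a₀) Q a b) (i : Fin n)
    (hi : i.val + 1 < n) : hookSumT b i ≥ -a i := by
  obtain ⟨-, ⟨rfl, -, -⟩, hvert⟩ := h
  obtain ⟨w, -, hw⟩ := hvert _ (diagonal_mem_vert ha₀)
  obtain ⟨hwQ, hwI⟩ := hw.ge rfl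
  obtain ⟨hw1, hw2⟩ := mem_solutionSet.1 hwQ
  have hoff : ∀ r c, r < c → entry (w + complete b) r c = 0 := by
    intro r c hrc
    set e : PosT n := ⟨⟨(r, c), hrc.le⟩, fun h => by
      have := Fin.lt_def.1 hrc
      simp only at h
      omega⟩ with he
    have h0 : route id a₀ e.1 = 0 := route_eq_zero hrc.ne' a₀
    have h1 := hwI e ⟨(diagonal_mem_vert ha₀).1, by rw [neg_P_mulVec, h0]; simp⟩
    rw [neg_P_mulVec] at h1
    rw [entry_of_le _ hrc.le]
    change w e.1 + complete b e.1 = 0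
    rw [complete_apply]
    linarith
  have hdiag : 0 ≤ entry (w + complete b) i i := by
    set e : PosT n := ⟨⟨(i, i), le_rfl⟩, fun h => hi.ne h.1⟩ with he
    rw [entry_of_le _ le_rfl]
    change 0 ≤ w e.1 + complete b e.1
    rw [complete_apply]
    linarith [hw2 e]
  have hsum : hookSum (w + complete b) i = entry (w + complete b) i i := by
    rw [hookSum, Finset.sum_eq_zero fun j hj => hoff i j (Finset.mem_Ioi.1 hj),
      Finset.sum_eq_zero fun j hj => hoff j i (Finset.mem_Iio.1 hj)]
    ring
  rw [hookSum_add, hw1] at hsum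
  rw [hookSumT]
  linarith

end Tesler

theorem mainTheorem1 (n : ℕ) (hn : 1 ≤ n) (a₀ : Fin n → ℝ) (ha₀ : ∀ i, 0 < a₀ i) :
    Deform.IsMinimalDescription (Tesler.L n) a₀ (-Tesler.P n) 0 (Tesler.Tes a₀) ∧
    Deform.deformationCone (Tesler.L n) (-Tesler.P n) 0 (Tesler.Tes a₀) =
      {p : (Fin n → ℝ) × Tesler.UT n |
        ∀ i : Fin n, i.val + 1 < n → Tesler.hookSumT p.2 i ≥ -p.1 i} ∧
    ∀ Q : Set (Tesler.U n),
      Deform.IsDeformation (Tesler.L n) (-Tesler.P n) 0 (Tesler.Tes a₀) Q →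
        ∃ a : Fin n → ℝ, (∀ i, 0 ≤ a i) ∧ ∃ t : Tesler.U n, Q = t +ᵥ Tesler.Tes a := by
  have ha := fun i => (ha₀ i).le
  refine ⟨Tesler.isMinimalDescription_Tes ha₀, ?_, ?_⟩
  · ext p
    exact ⟨fun ⟨Q, hQ⟩ => Tesler.hookSumT_ge_of_isDeformingVector ha hQ,
      fun h => ⟨_, Tesler.isDeformingVector_of_hookSumT_ge ha₀ h⟩⟩
  · rintro Q ⟨a, b, h⟩
    obtain ⟨a', ha', t, -, hQ⟩ := Tesler.exists_solutionSet_eq_vadd_Tes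
      (Tesler.hookSumT_ge_of_isDeformingVector ha h)
    exact ⟨a', ha', t, h.2.1.1.trans hQ⟩
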